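/- Let $T$ be a finite tree each of whose edges is a line segment of positive length; a point of $T$ is a vertex or a point in the interior of an edge, $\pi(x,y)$ denotes the simple path between two points $x,y$ of $T$, and $d(x,y)$ is its length. Let $P_1,\dots,P_n$ ($n\ge 1$) be uncertain points on $T$: $P_i$ has a weight $w_i\ge 0$ and finitely many possible locations $p_{i1},\dots,p_{im_i}$, which are points of $T$, with probabilities $f_{i1},\dots,f_{im_i}\ge 0$, $\sum_{j} f_{ij}=1$. For a point $x$ of $T$ put $$\mathsf{E}\mathrm{d}(x,P_i)=w_i\sum_{j=1}^{m_i} f_{ij}\, d(x,p_{ij}).$$ For each $i$ let $p_i^*$ be a median of $P_i$, that is, a point of $T$ at which $x\mapsto \mathsf{E}\mathrm{d}(x,P_i)$ attains its minimum over $T$. For $i\neq j$ let $c_{ij}$ be a point $x$ on $\pi(p_i^*,p_j^*)$ with $\mathsf{E}\mathrm{d}(x,P_i)=\mathsf{E}\mathrm{d}(x,P_j)$, if such a point exists; otherwise $c_{ij}$ is undefined. Let $k\ge 1$ be such that $T$ has at least $k$ points (which holds for every $k$ unless $T$ is a single vertex). Then the minimum $$\lambda_{opt}=\min_{C\subseteq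 T,\ |C|=k}\ \max_{1\le i\le n}\ \min_{c\in C}\ \mathsf{E}\mathrm{d}(c,P_i)$$ is attained, and at least one of the following holds: 1. $\lambda_{opt}=\mathsf{E}\mathrm{d}(p_i^*,P_i)$ for some $i$; 2. there are $i\ne j$ for which $c_{ij}$ exists, and $\lambda_{opt}=\mathsf{E}\mathrm{d}(c_{ij},P_i)=\mathsf{E}\mathrm{d}(c_{ij},P_j)$ for every admissible choice of $c_{ij}$. -/

import Mathlib

/-- A (finite) tree whose edges are line segments of positive length. -/
structure MetricTree (V : Type*) where
  /-- The underlying combinatorial tree. -/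
  graph : SimpleGraph V
  isTree : graph.IsTree
  /-- The edge lengths (only the values on edges matter). -/
  len : Sym2 V → ℝ
  len_pos : ∀ e ∈ graph.edgeSet, 0 < len e

namespace MetricTree

variable {V : Type*} [Fintype V]

/-- A point of the tree in barycentric coordinates: it is a vertex, or it lies in the interior
of an edge. The point of the edge `s(u, v)` of length `L` at distance `t` from `u` has
`wt u = 1 - t / L`, `wt v = t / L`, and weight `0` at the other vertices. (A tree contains no
triangle, so by `adj` at most two weights are nonzero.) -/
@[ext]
structure Point (T : MetricTree V) where
  wt : V → ℝ
  nonneg : ∀ v, 0 ≤ wt v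
  sum_eq_one : ∑ v, wt v = 1
  adj : ∀ u v, u ≠ v → wt u ≠ 0 → wt v ≠ 0 → T.graph.Adj u v

/-- The simple path between two vertices. -/
noncomputable def vpath {V : Type*} (T : MetricTree V) (u v : V) : T.graph.Walk u v :=
  (T.isTree.existsUnique_path u v).choose

/-- The distance between two vertices: the total length of the edges on the simple path. -/
noncomputable def vdist {V : Type*} (T : MetricTree V) (u v : V) : ℝ :=
  ((T.vpath u v).edges.map T.len).sum

variable (T : MetricTree V)

/-- The distance from a point `x` to a vertex `u` in its support, measured inside the
edge that carries `x`: if `x` lies on the edge `s(u, w)`, this is `x.wt w` times the length of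
that edge (and it is `0` if `x` is the vertex `u`). -/
noncomputable def offset (x : T.Point) (u : V) : ℝ :=
  ∑ w, x.wt w * T.vdist u w

/-- The lengths of the direct routes from `x` to `y`. A route stays inside one edge that
contains both points, or it leaves the edge of `x` at an endpoint `u`, follows the simple path
from `u` to an endpoint `v` of the edge of `y`, and proceeds from there to `y`. -/
def routeLengths (x y : T.Point) : Set ℝ :=
  {r | ∃ u v, T.graph.Adj u v ∧ (∀ w, w ≠ u → w ≠ v → x.wt w = 0 ∧ y.wt w = 0) ∧
      r = T.len s(u, v) * |x.wt u - y.wt u|} ∪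
  {r | ∃ u v, x.wt u ≠ 0 ∧ y.wt v ≠ 0 ∧
      r = T.offset x u + T.vdist u v + T.offset y v}

/-- The distance of two points of the tree: the length of the simple path between them, which
is the shortest of the (finitely many) direct routes. -/
noncomputable def dist (x y : T.Point) : ℝ :=
  sInf (T.routeLengths x y)

/-- The simple path between two points of the tree, as a set of points: in a tree these are
exactly the points `z` that split the distance from `x` to `y`. -/
def path (x y : T.Point) : Set T.Point :=
  {z | T.dist x z + T.dist z y = T.dist x y}

/-- A weighted uncertain point: finitely many possible locations on the tree, each with a
probability. -/
structure UncertainPoint where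
  /-- The number of locations. -/
  m : ℕ
  loc : Fin m → T.Point
  prob : Fin m → ℝ
  prob_nonneg : ∀ j, 0 ≤ prob j
  prob_sum : ∑ j, prob j = 1
  weight : ℝ
  weight_nonneg : 0 ≤ weight

variable {T}

/-- The weighted expected distance from `x` to the uncertain point `P`. -/
noncomputable def Ed (x : T.Point) (P : T.UncertainPoint) : ℝ :=
  P.weight * ∑ j, P.prob j * T.dist x (P.loc j)

/-- `p` is a median of `P`. -/
def IsMedian (p : T.Point) (P : T.UncertainPoint) : Prop :=
  ∀ x : T.Point, Ed p P ≤ Ed x P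

/-- The covering range `max_i min_{c ∈ C} Ed(c, P_i)` of a set `C` of centers. -/
noncomputable def coveringRange {n : ℕ} (P : Fin n → T.UncertainPoint) (C : Finset T.Point) : ℝ :=
  ⨆ i, ⨅ c : {c // c ∈ C}, Ed c.1 (P i)

/-- The covering ranges of all sets of `k` centers. -/
def coveringRanges {n : ℕ} (P : Fin n → T.UncertainPoint) (k : ℕ) : Set ℝ :=
  {r | ∃ C : Finset T.Point, C.card = k ∧ coveringRange P C = r}

/-- The optimal covering range of the `k`-center problem. -/
noncomputable def optCoveringRange {n : ℕ} (P : Fin n → T.UncertainPoint) (k : ℕ) : ℝ :=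
  sInf (coveringRanges P k)

/-- The points `x` of the path between `p` and `q` with `Ed(x, P) = Ed(x, Q)`; for medians `p`
of `P` and `q` of `Q` these are the possible choices of the crossing point. -/
def crossings (p q : T.Point) (P Q : T.UncertainPoint) : Set T.Point :=
  {x | x ∈ T.path p q ∧ Ed x P = Ed x Q}

end MetricTree

/-! Distances in a tree are convex along paths. Hence so is each expected distance `Ed · P`, and its
sublevel sets are convex. By the Helly property one center serves a group of uncertain points within
a given radius as soon as one exists for every two of them. So the best radius of a group is the
largest of its pair values `r i j`, where `r i j` is the best radius for `i` and `j` together, and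
the optimum is one of these finitely many numbers (`exists_pair_le_coveringRange`,
`isLeast_coveringRanges`).

For a pair, if the median of one uncertain point serves the other no worse, its own cost is the pair
value. Otherwise the difference of the two costs changes sign between the medians, and every
crossing point is optimal: leaving it in any direction means moving away from a median, along which
that cost cannot decrease (`exists_optimal_pair_center`).

This uses only geodesics and the four-point condition. Both are proved for `dist` by rooting the
tree and writing the distance as a sum of cut metrics, one per edge (`cutDist`). -/

/-- A function `d` that makes `X` a geodesic pseudometric space satisfying the four-point
condition: the metric characterization of real trees, up to identification of points at
distance zero. -/
structure IsTreeDist {X : Type*} (d : X → X → ℝ) : Prop where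
  self : ∀ x, d x x = 0
  symm : ∀ x y, d x y = d y x
  triangle : ∀ x y z, d x z ≤ d x y + d y z
  four_point : ∀ x y z w, d x y + d z w ≤ max (d x z + d y w) (d x w + d y z)
  geodesic : ∀ x y s, 0 ≤ s → s ≤ d x y → ∃ z, d x z = s ∧ d z y = d x y - s

/-! ### Geometry from the four-point condition: medians, convexity, Helly -/

namespace IsTreeDist

variable {X : Type*} {d : X → X → ℝ}

theorem nonneg (h : IsTreeDist d) (x y : X) : 0 ≤ d x y := by
  have h1 := h.triangle x y x
  have h2 := h.symm x y
  have h3 := h.self x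
  linarith

/-- Any three points have a median: a point on each of the three segments between them. -/
theorem exists_median (h : IsTreeDist d) (x y z : X) :
    ∃ m, d x m + d m y = d x y ∧ d y m + d m z = d y z ∧ d x m + d m z = d x z := by
  have hyxz := h.triangle y x z
  have hxyz := h.triangle x y z
  have hxzy := h.triangle x z y
  rw [h.symm y x] at hyxz
  rw [h.symm z y] at hxzy
  -- The distance from `x` is the Gromov product of `y` and `z` at `x`, where the segments to `y`
  -- and `z` separate.
  obtain ⟨m, hm1, hm2⟩ := h.geodesic x y ((d x y + d x z - d y z) / 2)
    (by linarith) (by linarith)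
  have h4 := h.four_point x y m z
  have hym := h.symm y m
  have h5 : d x y + d m z ≤ (d x y + d x z + d y z) / 2 :=
    h4.trans (max_le (by linarith) (by linarith))
  refine ⟨m, by linarith, ?_, ?_⟩
  · linarith [h.triangle y m z]
  · linarith [h.triangle x m z]

/-- Distances are convex along segments. -/
theorem convex (h : IsTreeDist d) {x y z : X} (hz : d x z + d z y = d x y) (q : X) :
    d x y * d z q ≤ d z y * d x q + d x z * d y q := by
  have h4 := h.four_point x y z q
  have ha := h.nonneg x z
  have hb := h.nonneg z y
  have h1 := h.triangle x y q
  have h2 := h.triangle y x q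
  have h3 := h.symm x y
  have h5 := h.symm y z
  rw [← hz] at h1 h3 h4 ⊢
  -- The four-point condition puts `z` on a segment to `q` from `y` or from `x`; the triangle
  -- inequality handles the other end.
  rcases le_max_iff.1 h4 with h6 | h6
  · have h7 : d z q ≤ d y q - d z y := by linarith
    have h8 := mul_le_mul_of_nonneg_left h7 (add_nonneg ha hb)
    have h9 := mul_nonneg hb (show 0 ≤ d x q + (d x z + d z y) - d y q by linarith)
    linarith
  · have h7 : d z q ≤ d x q - d x z := by linarith
    have h8 := mul_le_mul_of_nonneg_left h7 (add_nonneg ha hb)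
    have h9 := mul_nonneg ha (show 0 ≤ d y q + (d x z + d z y) - d x q by linarith)
    linarith

/-- On a segment, the distance of two points is the difference of their distances to an end. -/
theorem le_abs_sub_of_mem_segment (h : IsTreeDist d) {x y z w : X}
    (hz : d x z + d z y = d x y) (hw : d x w + d w y = d x y) :
    d z w ≤ |d x z - d x w| := by
  have h4 := h.four_point x y z w
  have h1 := h.symm y w
  have h2 := h.symm y z
  rcases le_max_iff.1 h4 with h6 | h6
  · linarith [le_abs_self (d x z - d x w)]
  · linarith [neg_le_abs (d x z - d x w)]

/-- A Lipschitz function that changes sign between `x` and `y` vanishes somewhere on the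
segment between them. -/
theorem exists_zero_mem_segment (h : IsTreeDist d) {f : X → ℝ} {K : ℝ}
    (hf : ∀ x y, |f x - f y| ≤ K * d x y) {x y : X} (hx : f x ≤ 0) (hy : 0 ≤ f y) :
    ∃ z, d x z + d z y = d x y ∧ f z = 0 := by
  have hD := h.nonneg x y
  have : Nonempty X := ⟨x⟩
  -- The points `γ s` are chosen independently, yet they form a 1-Lipschitz curve by
  -- `le_abs_sub_of_mem_segment`, so the intermediate value theorem applies.
  choose! γ hγ using h.geodesic x y
  have hseg : ∀ s ∈ Set.Icc 0 (d x y), d x (γ s) + d (γ s) y = d x y := fun s hs => by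
    rw [(hγ s hs.1 hs.2).1, (hγ s hs.1 hs.2).2]; ring
  have hK : ∀ s ∈ Set.Icc 0 (d x y), ∀ t ∈ Set.Icc 0 (d x y),
      dist (f (γ s)) (f (γ t)) ≤ (|K|).toNNReal * dist s t := fun s hs t ht => by
    rw [Real.coe_toNNReal _ (abs_nonneg K), Real.dist_eq, Real.dist_eq]
    have h1 := h.le_abs_sub_of_mem_segment (hseg s hs) (hseg t ht)
    rw [(hγ s hs.1 hs.2).1, (hγ t ht.1 ht.2).1] at h1
    calc |f (γ s) - f (γ t)| ≤ K * d (γ s) (γ t) := hf _ _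
      _ ≤ |K| * d (γ s) (γ t) := by gcongr; exacts [h.nonneg _ _, le_abs_self K]
      _ ≤ |K| * |s - t| := by gcongr
  have hcont : ContinuousOn (fun s => f (γ s)) (Set.Icc 0 (d x y)) :=
    (LipschitzOnWith.of_dist_le_mul hK).continuousOn
  -- `d` is only a pseudometric: `γ 0` need not be `x`, but `f` cannot tell them apart.
  have hzero : ∀ z w, d z w = 0 → f z = f w := fun z w hzw => by
    have := hf z w
    rw [hzw, mul_zero] at this
    exact sub_eq_zero.1 (abs_nonpos_iff.1 this)
  have h0 : f x = f (γ 0) := hzero _ _ (hγ 0 le_rfl hD).1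
  have h1 : f (γ (d x y)) = f y := hzero _ _ (by rw [(hγ _ hD le_rfl).2, sub_self])
  obtain ⟨s, hs, hs0⟩ := intermediate_value_Icc hD hcont
    (show (0 : ℝ) ∈ Set.Icc (f (γ 0)) (f (γ (d x y))) from ⟨h0 ▸ hx, h1 ▸ hy⟩)
  exact ⟨γ s, hseg s hs, hs0⟩

/-- The Helly property: finitely many pairwise intersecting convex sets have a common point. -/
theorem helly [Nonempty X] (h : IsTreeDist d) {ι : Type*} (s : Finset ι) (S : ι → Set X)
    (hconv : ∀ i ∈ s, ∀ x ∈ S i, ∀ y ∈ S i, ∀ z, d x z + d z y = d x y → z ∈ S i)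
    (hmeet : ∀ i ∈ s, ∀ j ∈ s, ∃ x, x ∈ S i ∧ x ∈ S j) : ∃ x, ∀ i ∈ s, x ∈ S i := by
  classical
  induction s using Finset.induction_on generalizing S with
  | empty => exact ⟨Classical.arbitrary X, by simp⟩
  | insert a s _ ih =>
    have ha := Finset.mem_insert_self a s
    rcases s.eq_empty_or_nonempty with rfl | ⟨b, hb⟩
    · obtain ⟨x, hx, -⟩ := hmeet a ha a ha
      exact ⟨x, by simpa using hx⟩
    have hs : ∀ i ∈ s, i ∈ insert a s := fun i => Finset.mem_insert_of_mem
    -- Cutting every set down to `S a` keeps pairwise intersections nonempty: this is Helly for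
    -- three sets, witnessed by the median of one point from each pairwise intersection.
    obtain ⟨x, hx⟩ := ih (fun i => S i ∩ S a)
      (fun i hi x hx y hy z hz => ⟨hconv i (hs i hi) x hx.1 y hy.1 z hz,
        hconv a ha x hx.2 y hy.2 z hz⟩)
      (fun i hi j hj => by
        obtain ⟨x, hxi, hxj⟩ := hmeet i (hs i hi) j (hs j hj)
        obtain ⟨y, hyj, hya⟩ := hmeet j (hs j hj) a ha
        obtain ⟨z, hzi, hza⟩ := hmeet i (hs i hi) a ha
        obtain ⟨m, h1, h2, h3⟩ := h.exists_median x y z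
        have hmi := hconv i (hs i hi) x hxi z hzi m h3
        have hmj := hconv j (hs j hj) x hxj y hyj m h1
        have hma := hconv a ha y hya z hza m h2
        exact ⟨m, ⟨hmi, hma⟩, hmj, hma⟩)
    refine ⟨x, fun i hi => ?_⟩
    rcases Finset.mem_insert.1 hi with rfl | hi
    · exact (hx b hb).2
    · exact (hx i hi).1

end IsTreeDist

namespace MetricTree

/-! ### Convexity of the expected distance and optimal centers of pairs -/

section Expectation

variable {V : Type*} [Fintype V] {T : MetricTree V}

theorem abs_Ed_sub_le (h : IsTreeDist T.dist) (x y : T.Point) (P : T.UncertainPoint) :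
    |Ed x P - Ed y P| ≤ P.weight * T.dist x y := by
  unfold Ed
  rw [← mul_sub, ← Finset.sum_sub_distrib, abs_mul, abs_of_nonneg P.weight_nonneg]
  refine mul_le_mul_of_nonneg_left ?_ P.weight_nonneg
  calc |∑ j, (P.prob j * T.dist x (P.loc j) - P.prob j * T.dist y (P.loc j))|
      ≤ ∑ j, |P.prob j * T.dist x (P.loc j) - P.prob j * T.dist y (P.loc j)| :=
        Finset.abs_sum_le_sum_abs _ _
    _ ≤ ∑ j, P.prob j * T.dist x y := by
        refine Finset.sum_le_sum fun j _ => ?_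
        rw [← mul_sub, abs_mul, abs_of_nonneg (P.prob_nonneg j)]
        refine mul_le_mul_of_nonneg_left (abs_le.2 ⟨?_, ?_⟩) (P.prob_nonneg j)
        · linarith [h.triangle y x (P.loc j), h.symm x y]
        · linarith [h.triangle x y (P.loc j)]
    _ = T.dist x y := by rw [← Finset.sum_mul, P.prob_sum, one_mul]

theorem Ed_convex (h : IsTreeDist T.dist) {x y z : T.Point} (hz : z ∈ T.path x y)
    (P : T.UncertainPoint) :
    T.dist x y * Ed z P ≤ T.dist z y * Ed x P + T.dist x z * Ed y P := by
  unfold Ed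
  have key : T.dist x y * ∑ j, P.prob j * T.dist z (P.loc j) ≤
      T.dist z y * ∑ j, P.prob j * T.dist x (P.loc j) +
        T.dist x z * ∑ j, P.prob j * T.dist y (P.loc j) := by
    rw [Finset.mul_sum, Finset.mul_sum, Finset.mul_sum, ← Finset.sum_add_distrib]
    refine Finset.sum_le_sum fun j _ => ?_
    have := mul_le_mul_of_nonneg_left (h.convex hz (P.loc j)) (P.prob_nonneg j)
    linarith
  have := mul_le_mul_of_nonneg_left key P.weight_nonneg
  linarith

theorem Ed_le_of_mem_path (h : IsTreeDist T.dist) {x y z : T.Point} (hz : z ∈ T.path x y)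
    {P : T.UncertainPoint} {r : ℝ} (hx : Ed x P ≤ r) (hy : Ed y P ≤ r) : Ed z P ≤ r := by
  have hz' : T.dist x z + T.dist z y = T.dist x y := hz
  have hxz := h.nonneg x z
  have hzy := h.nonneg z y
  rcases (h.nonneg x y).eq_or_lt with h0 | h0
  · have h1 := abs_Ed_sub_le h x z P
    rw [show T.dist x z = 0 by linarith, mul_zero] at h1
    rwa [← sub_eq_zero.1 (abs_nonpos_iff.1 h1)]
  · have h1 := Ed_convex h hz P
    have h2 := mul_le_mul_of_nonneg_left hx hzy
    have h3 := mul_le_mul_of_nonneg_left hy hxz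
    refine le_of_mul_le_mul_left ?_ h0
    calc _ ≤ _ := h1
      _ ≤ T.dist z y * r + T.dist x z * r := add_le_add h2 h3
      _ = T.dist x y * r := by rw [← hz']; ring

/-- A convex function does not decrease along a path that leaves its minimum. -/
theorem IsMedian.Ed_le_of_mem_path (h : IsTreeDist T.dist) {p x z : T.Point}
    {P : T.UncertainPoint} (hp : IsMedian p P) (hz : z ∈ T.path p x) : Ed z P ≤ Ed x P :=
  MetricTree.Ed_le_of_mem_path h hz (hp x) le_rfl

/-- A crossing point of two uncertain points is an optimal common center for them. -/
theorem Ed_crossing_le (h : IsTreeDist T.dist) {p q c : T.Point} {P Q : T.UncertainPoint}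
    (hp : IsMedian p P) (hq : IsMedian q Q) (hc : c ∈ crossings p q P Q) (x : T.Point) :
    Ed c P ≤ max (Ed x P) (Ed x Q) := by
  obtain ⟨hcp, hce⟩ := hc
  -- `m` is where the way from `x` meets the path from `p` to `q`. The crossing `c` lies between `p`
  -- and `m` or between `m` and `q`, so it is no worse than `m`, and hence than `x`, for `P` or for
  -- `Q`.
  obtain ⟨m, h1, h2, h3⟩ := h.exists_median p q x
  have hcp' : T.dist p c + T.dist c q = T.dist p q := hcp
  have hd := h.le_abs_sub_of_mem_segment hcp' h1
  rcases le_total (T.dist p c) (T.dist p m) with hle | hle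
  · rw [abs_of_nonpos (by linarith)] at hd
    refine le_max_of_le_left ((hp.Ed_le_of_mem_path h (x := m) ?_).trans
      (hp.Ed_le_of_mem_path h h3))
    exact le_antisymm (by linarith) (h.triangle _ _ _)
  · rw [abs_of_nonneg (by linarith)] at hd
    rw [hce]
    refine le_max_of_le_right ((hq.Ed_le_of_mem_path h (x := m) ?_).trans
      (hq.Ed_le_of_mem_path h h2))
    refine le_antisymm ?_ (h.triangle _ _ _)
    linarith [h.symm q c, h.symm q m]

/-- Two uncertain points have an optimal common center, which is a median of one of them or a
crossing point. -/
theorem exists_optimal_pair_center (h : IsTreeDist T.dist) {p q : T.Point}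
    {P Q : T.UncertainPoint} (hp : IsMedian p P) (hq : IsMedian q Q) :
    ∃ r z, Ed z P ≤ r ∧ Ed z Q ≤ r ∧ (∀ x, r ≤ max (Ed x P) (Ed x Q)) ∧
      (r = Ed p P ∨ r = Ed q Q ∨
        (crossings p q P Q).Nonempty ∧ ∀ c ∈ crossings p q P Q, r = Ed c P ∧ r = Ed c Q) := by
  rcases le_or_gt (Ed p Q) (Ed p P) with h1 | h1
  · exact ⟨Ed p P, p, le_rfl, h1, fun x => le_max_of_le_left (hp x), Or.inl rfl⟩
  rcases le_or_gt (Ed q P) (Ed q Q) with h2 | h2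
  · exact ⟨Ed q Q, q, h2, le_rfl, fun x => le_max_of_le_right (hq x), Or.inr (Or.inl rfl)⟩
  obtain ⟨c, hc1, hc2⟩ := h.exists_zero_mem_segment (f := fun x => Ed x P - Ed x Q)
    (K := P.weight + Q.weight) (fun x y => by
      have := abs_Ed_sub_le h x y P
      have := abs_Ed_sub_le h x y Q
      calc |Ed x P - Ed x Q - (Ed y P - Ed y Q)|
          = |(Ed x P - Ed y P) - (Ed x Q - Ed y Q)| := by congr 1; ring
        _ ≤ |Ed x P - Ed y P| + |Ed x Q - Ed y Q| := abs_sub _ _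
        _ ≤ (P.weight + Q.weight) * T.dist x y := by linarith)
    (x := p) (y := q) (by linarith) (by linarith)
  have hc : c ∈ crossings p q P Q := ⟨hc1, sub_eq_zero.1 hc2⟩
  refine ⟨Ed c P, c, le_rfl, hc.2.ge, Ed_crossing_le h hp hq hc, Or.inr (Or.inr ⟨⟨c, hc⟩, ?_⟩)⟩
  -- Two crossings bound each other, so all have the same value.
  intro c' hc'
  have h3 := Ed_crossing_le h hp hq hc c'
  have h4 := Ed_crossing_le h hp hq hc' c
  rw [← hc'.2, max_self] at h3
  rw [← hc.2, max_self] at h4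
  exact ⟨le_antisymm h3 h4, (le_antisymm h3 h4).trans hc'.2⟩

end Expectation

/-! ### Reduction of the k-center problem to pairs -/

section Covering

variable {V : Type*} [Fintype V] {T : MetricTree V} {n : ℕ}

theorem coveringRange_le [Nonempty (Fin n)] {P : Fin n → T.UncertainPoint}
    {C : Finset T.Point} {r : ℝ} (h : ∀ i, ∃ c ∈ C, Ed c (P i) ≤ r) : coveringRange P C ≤ r := by
  refine ciSup_le fun i => ?_
  obtain ⟨c, hc, hle⟩ := h i
  exact (ciInf_le (Set.finite_range _).bddBelow (⟨c, hc⟩ : {c // c ∈ C})).trans hle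

theorem exists_Ed_le_coveringRange (P : Fin n → T.UncertainPoint) {C : Finset T.Point}
    (hC : C.Nonempty) (i : Fin n) : ∃ c ∈ C, Ed c (P i) ≤ coveringRange P C := by
  have : Nonempty {c // c ∈ C} := hC.to_subtype
  obtain ⟨c, hc⟩ := exists_eq_ciInf_of_finite (f := fun c : {c // c ∈ C} => Ed c.1 (P i))
  refine ⟨c.1, c.2, hc.le.trans ?_⟩
  exact le_ciSup (f := fun i => ⨅ c : {c // c ∈ C}, Ed c.1 (P i)) (Set.finite_range _).bddAbove i

/-- If `r i j` is the optimal covering range of the pair `i, j` by one center, then the covering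
range of every `C` is bounded below by some `r i j` that is achievable with as many centers. -/
theorem exists_pair_le_coveringRange [Nonempty (Fin n)] (h : IsTreeDist T.dist)
    {P : Fin n → T.UncertainPoint} {r : Fin n → Fin n → ℝ}
    (hr : ∀ i j, ∃ z, Ed z (P i) ≤ r i j ∧ Ed z (P j) ≤ r i j)
    (hr' : ∀ i j x, r i j ≤ max (Ed x (P i)) (Ed x (P j)))
    {C : Finset T.Point} (hC : C.Nonempty) :
    ∃ i j, r i j ≤ coveringRange P C ∧
      ∃ C' : Finset T.Point, C'.card = C.card ∧ coveringRange P C' ≤ r i j := by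
  classical
  choose c hcC hc using exists_Ed_le_coveringRange P hC
  let i₀ : Fin n := Classical.arbitrary _
  -- The worst pair among those sharing a center under the assignment `c`.
  obtain ⟨⟨i, j⟩, hij, hmax⟩ := Finset.exists_max_image
    (Finset.univ.filter fun a : Fin n × Fin n => c a.1 = c a.2) (fun a => r a.1 a.2)
    ⟨(i₀, i₀), by simp⟩
  simp only [Finset.mem_filter, Finset.mem_univ, true_and] at hij hmax
  refine ⟨i, j, (hr' i j (c i)).trans (max_le (hc i) (hij ▸ hc j)), ?_⟩
  have : Nonempty T.Point := ⟨c i₀⟩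
  have key : ∀ x, ∃ x', ∀ l ∈ Finset.univ.filter fun l => c l = x, Ed x' (P l) ≤ r i j :=
    fun x => h.helly _ (fun l => {y | Ed y (P l) ≤ r i j})
      (fun l _ y hy y' hy' z hz => Ed_le_of_mem_path h hz hy hy')
      (fun l hl l' hl' => by
        simp only [Finset.mem_filter, Finset.mem_univ, true_and] at hl hl'
        obtain ⟨z, hz, hz'⟩ := hr l l'
        have := hmax (l, l') (hl.trans hl'.symm)
        exact ⟨z, hz.trans this, hz'.trans this⟩)
  choose g hg using key
  -- The new centers may coincide; points of `C` restore the exact cardinality.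
  obtain ⟨C', hsub, -, hcard⟩ := Finset.exists_subsuperset_card_eq
    (Finset.subset_union_left (s₁ := C.image g) (s₂ := C)) Finset.card_image_le
    (Finset.card_le_card Finset.subset_union_right)
  exact ⟨C', hcard, coveringRange_le fun l =>
    ⟨g (c l), hsub (Finset.mem_image_of_mem g (hcC l)), hg (c l) l (by simp)⟩⟩

/-- The least achievable pair value is a lower bound, because every covering range dominates some
achievable one. -/
theorem isLeast_coveringRanges [Nonempty (Fin n)] (h : IsTreeDist T.dist)
    {P : Fin n → T.UncertainPoint} {r : Fin n → Fin n → ℝ}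
    (hr : ∀ i j, ∃ z, Ed z (P i) ≤ r i j ∧ Ed z (P j) ≤ r i j)
    (hr' : ∀ i j x, r i j ≤ max (Ed x (P i)) (Ed x (P j)))
    {k : ℕ} (hk : 1 ≤ k) (hT : ∃ C : Finset T.Point, C.card = k) :
    ∃ i j, IsLeast (coveringRanges P k) (r i j) := by
  classical
  have key : ∀ C : Finset T.Point, C.card = k → ∃ i j, r i j ≤ coveringRange P C ∧
      ∃ C' : Finset T.Point, C'.card = k ∧ coveringRange P C' ≤ r i j := fun C hC => by
    have := exists_pair_le_coveringRange h hr hr' (C := C) (Finset.card_pos.1 (by omega))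
    rwa [hC] at this
  obtain ⟨C₀, hC₀⟩ := hT
  obtain ⟨i₀, j₀, -, h₀⟩ := key C₀ hC₀
  obtain ⟨⟨i, j⟩, hij, hmin⟩ := Finset.exists_min_image
    (Finset.univ.filter fun a : Fin n × Fin n =>
      ∃ C' : Finset T.Point, C'.card = k ∧ coveringRange P C' ≤ r a.1 a.2)
    (fun a => r a.1 a.2) ⟨(i₀, j₀), by simpa using h₀⟩
  simp only [Finset.mem_filter, Finset.mem_univ, true_and] at hij hmin
  have hlb : ∀ C : Finset T.Point, C.card = k → r i j ≤ coveringRange P C := fun C hC => by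
    obtain ⟨i', j', hle, hfeas⟩ := key C hC
    exact (hmin (i', j') hfeas).trans hle
  obtain ⟨C, hC, hle⟩ := hij
  refine ⟨i, j, ⟨C, hC, le_antisymm hle (hlb C hC)⟩, ?_⟩
  rintro _ ⟨C', hC', rfl⟩
  exact hlb C' hC'

end Covering

end MetricTree

namespace MetricTree

/-! ### Ancestors in the rooted tree -/

section Rooted

variable {V : Type*} (T : MetricTree V) (r : V)

theorem vpath_isPath (u v : V) : (T.vpath u v).IsPath :=
  (T.isTree.existsUnique_path u v).choose_spec.1

variable {T} in
theorem eq_vpath {u v : V} {p : T.graph.Walk u v} (hp : p.IsPath) : p = T.vpath u v :=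
  (T.isTree.existsUnique_path u v).choose_spec.2 p hp

/-- `a` is an ancestor of `w` (or equal to it) in the tree rooted at `r`. -/
def Anc (a w : V) : Prop := a ∈ (T.vpath r w).support

/-- `c` is a child of `b` in the tree rooted at `r`. -/
structure IsChild (b c : V) : Prop where
  not_anc : ¬ T.Anc r c b
  anc_iff : ∀ a, T.Anc r a c ↔ T.Anc r a b ∨ a = c
  penultimate : (T.vpath r c).penultimate = b

variable {T r}

theorem anc_refl (a : V) : T.Anc r a a := (T.vpath r a).end_mem_support

theorem anc_root (a : V) : T.Anc r r a := (T.vpath r a).start_mem_support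

theorem Anc.trans {a b c : V} (hab : T.Anc r a b) (hbc : T.Anc r b c) : T.Anc r a c := by
  classical
  have h := eq_vpath ((T.vpath_isPath r c).takeUntil hbc)
  rw [Anc, ← h] at hab
  exact (T.vpath r c).support_takeUntil_subset_support hbc hab

theorem Anc.length_lt {a b : V} (hab : T.Anc r a b) (hne : a ≠ b) :
    (T.vpath r a).length < (T.vpath r b).length := by
  classical
  rw [← eq_vpath ((T.vpath_isPath r b).takeUntil hab)]
  exact SimpleGraph.Walk.length_takeUntil_lt_length hab hne

theorem Anc.antisymm {a b : V} (hab : T.Anc r a b) (hba : T.Anc r b a) : a = b := by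
  by_contra hne
  exact lt_asymm (hab.length_lt hne) (hba.length_lt (Ne.symm hne))

theorem isChild_of_adj_of_not_anc {b c : V} (h : T.graph.Adj b c) (hc : ¬ T.Anc r c b) :
    T.IsChild r b c := by
  have heq := eq_vpath ((T.vpath_isPath r b).concat hc h)
  refine ⟨hc, fun a => ?_, ?_⟩
  · rw [Anc, ← heq, SimpleGraph.Walk.support_concat]
    simp [Anc]
  · rw [← heq, SimpleGraph.Walk.penultimate_concat]

theorem isChild_or_isChild {b c : V} (h : T.graph.Adj b c) :
    T.IsChild r b c ∨ T.IsChild r c b := by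
  by_cases hc : T.Anc r c b
  · refine Or.inr (isChild_of_adj_of_not_anc h.symm fun hb => h.ne (hb.antisymm hc))
  · exact Or.inl (isChild_of_adj_of_not_anc h hc)

theorem IsChild.anc {b c : V} (h : T.IsChild r b c) : T.Anc r b c :=
  (h.anc_iff b).2 (Or.inl (anc_refl b))

theorem IsChild.parent_unique {b b' c : V} (h : T.IsChild r b c) (h' : T.IsChild r b' c) :
    b = b' := h.penultimate.symm.trans h'.penultimate

theorem not_adj_of_adj_of_adj {u v w : V} (huv : T.graph.Adj u v) (hvw : T.graph.Adj v w) :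
    ¬ T.graph.Adj u w := fun huw => by
  have h1 := eq_vpath (p := huw.toWalk) (by simpa using huw.ne)
  have h2 := eq_vpath (p := .cons huv hvw.toWalk) (by simp [huv.ne, huw.ne, hvw.ne])
  have h3 := congrArg SimpleGraph.Walk.length (h1.trans h2.symm)
  simp at h3

/-- The ancestors of a vertex form a chain. -/
theorem Anc.total {a b w : V} (ha : T.Anc r a w) (hb : T.Anc r b w) :
    T.Anc r a b ∨ T.Anc r b a := by
  -- Induction along a walk to the root: a step down keeps all ancestors, a step up loses only the
  -- current vertex.
  obtain ⟨p⟩ := T.isTree.connected.preconnected w r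
  induction p generalizing a b with
  | nil => exact Or.inl (ha.antisymm (anc_root a) ▸ anc_root b)
  | cons h p ih =>
    rcases isChild_or_isChild h with h1 | h1
    · exact ih (ha.trans h1.anc) (hb.trans h1.anc)
    · rcases (h1.anc_iff a).1 ha with ha' | rfl
      · rcases (h1.anc_iff b).1 hb with hb' | rfl
        · exact ih ha' hb'
        · exact Or.inl ha
      · exact Or.inr hb

/-- The subtree below `u'` is entered and left only through the edge to its parent `u`, which the
walk avoids. -/
theorem anc_iff_of_walk {b c u u' : V} (p : T.graph.Walk b c) (hp : u ∉ p.support)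
    (h : T.IsChild r u u') : T.Anc r u' b ↔ T.Anc r u' c := by
  induction p with
  | nil => rfl
  | cons hadj p ih =>
    rw [SimpleGraph.Walk.support_cons, List.mem_cons, not_or] at hp
    rw [← ih hp.2]
    have hu := fun e : u = _ => hp.2 (e ▸ p.start_mem_support)
    rcases isChild_or_isChild (r := r) hadj with h1 | h1
    · rw [h1.anc_iff, or_iff_left]
      rintro rfl
      exact hp.1 (h.parent_unique h1)
    · rw [h1.anc_iff, or_iff_left]
      rintro rfl
      exact hu (h.parent_unique h1)

theorem anc_iff_of_walk' {b c u : V} (p : T.graph.Walk b c) (hp : u ∉ p.support) :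
    T.Anc r u b ↔ T.Anc r u c := by
  induction p with
  | nil => rfl
  | cons hadj p ih =>
    rw [SimpleGraph.Walk.support_cons, List.mem_cons, not_or] at hp
    rw [← ih hp.2]
    have hu := fun e : u = _ => hp.2 (e ▸ p.start_mem_support)
    rcases isChild_or_isChild (r := r) hadj with h1 | h1
    · rw [h1.anc_iff, or_iff_left hu]
    · rw [h1.anc_iff, or_iff_left hp.1]

variable (T r) in
open Classical in
/-- The indicator function of `Anc`. -/
noncomputable def ind (a w : V) : ℝ := if T.Anc r a w then 1 else 0

variable (T r) in
open Classical in
/-- The length of the edge from `a` to its parent, and `0` for the root. -/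
noncomputable def edgeLen (a : V) : ℝ :=
  if a = r then 0 else T.len s((T.vpath r a).penultimate, a)

theorem ind_of_anc {a w : V} (h : T.Anc r a w) : T.ind r a w = 1 := if_pos h

theorem ind_of_not_anc {a w : V} (h : ¬ T.Anc r a w) : T.ind r a w = 0 := if_neg h

theorem ind_congr {a w w' : V} (h : T.Anc r a w ↔ T.Anc r a w') : T.ind r a w = T.ind r a w' := by
  by_cases h' : T.Anc r a w
  · rw [ind_of_anc h', ind_of_anc (h.1 h')]
  · rw [ind_of_not_anc h', ind_of_not_anc (mt h.2 h')]

theorem ind_nonneg (a w : V) : 0 ≤ T.ind r a w := by unfold ind; split <;> norm_num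

theorem ind_le_one (a w : V) : T.ind r a w ≤ 1 := by unfold ind; split <;> norm_num

theorem edgeLen_nonneg (a : V) : 0 ≤ T.edgeLen r a := by
  unfold edgeLen
  split_ifs with h
  · exact le_rfl
  · exact (T.len_pos _ ((T.vpath r a).adj_penultimate
      (SimpleGraph.Walk.not_nil_of_ne (Ne.symm h)))).le

theorem IsChild.edgeLen_eq {b c : V} (h : T.IsChild r b c) : T.edgeLen r c = T.len s(b, c) := by
  rw [edgeLen, if_neg, h.penultimate]
  rintro rfl
  exact h.not_anc (anc_root b)

theorem IsChild.ind_eq {a b c : V} (h : T.IsChild r b c) (ha : a ≠ c) :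
    T.ind r a c = T.ind r a b :=
  ind_congr (by rw [h.anc_iff, or_iff_left ha])

end Rooted

/-! ### The distance as a sum of cut metrics -/

section Coordinates

variable {V : Type*} [Fintype V] (T : MetricTree V) (r : V)

/-- The total weight of a point on the descendants of `a`. It tells how much of the edge from
`a` to its parent lies between the root and the point. -/
noncomputable def mass (a : V) (x : T.Point) : ℝ := ∑ w, x.wt w * T.ind r a w

/-- The distance of two points, as a weighted sum of cut metrics. -/
noncomputable def cutDist (x y : T.Point) : ℝ :=
  ∑ a, T.edgeLen r a * |T.mass r a x - T.mass r a y|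

open Classical in
/-- A vertex, as a point of the tree. -/
noncomputable def vertexPoint (v : V) : T.Point where
  wt w := if w = v then 1 else 0
  nonneg w := by split <;> norm_num
  sum_eq_one := by simp
  adj u w hne hu hw := by
    simp only [ne_eq, ite_eq_right_iff, one_ne_zero, imp_false, not_not] at hu hw
    exact absurd (hu.trans hw.symm) hne

variable {T r}

theorem mass_vertexPoint (a v : V) : T.mass r a (T.vertexPoint v) = T.ind r a v := by
  classical simp [mass, vertexPoint]

theorem mass_nonneg (a : V) (x : T.Point) : 0 ≤ T.mass r a x :=
  Finset.sum_nonneg fun w _ => mul_nonneg (x.nonneg w) (ind_nonneg a w)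

theorem mass_eq_of_forall {a : V} {x : T.Point} {t : ℝ}
    (h : ∀ w, x.wt w ≠ 0 → T.ind r a w = t) : T.mass r a x = t := by
  calc T.mass r a x = ∑ w, x.wt w * t := Finset.sum_congr rfl fun w _ => by
        by_cases hw : x.wt w = 0
        · rw [hw, zero_mul, zero_mul]
        · rw [h w hw]
    _ = t := by rw [← Finset.sum_mul, x.sum_eq_one, one_mul]

theorem one_sub_mass (a : V) (x : T.Point) :
    1 - T.mass r a x = ∑ w, x.wt w * (1 - T.ind r a w) := by
  simp only [mul_sub, mul_one, Finset.sum_sub_distrib, x.sum_eq_one, mass]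

theorem mass_le_one (a : V) (x : T.Point) : T.mass r a x ≤ 1 := by
  rw [← sub_nonneg, one_sub_mass]
  exact Finset.sum_nonneg fun w _ => mul_nonneg (x.nonneg w) (sub_nonneg.2 (ind_le_one a w))

theorem exists_anc_of_mass_pos {a : V} {x : T.Point} (h : 0 < T.mass r a x) :
    ∃ w, x.wt w ≠ 0 ∧ T.Anc r a w := by
  by_contra! hcon
  exact h.ne' (mass_eq_of_forall fun w hw => ind_of_not_anc (hcon w hw))

/-- A point below a strict descendant of `a` has full mass at `a`. -/
theorem mass_eq_one_of_anc {a b : V} {x : T.Point} (hab : T.Anc r a b) (hne : a ≠ b)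
    (h : 0 < T.mass r b x) : T.mass r a x = 1 := by
  obtain ⟨w, hw, hbw⟩ := exists_anc_of_mass_pos h
  refine mass_eq_of_forall fun w' hw' => ind_of_anc ?_
  have haw := hab.trans hbw
  rcases eq_or_ne w' w with rfl | hww
  · exact haw
  rcases isChild_or_isChild (r := r) (x.adj w' w hww hw' hw) with h1 | h1
  · rcases (h1.anc_iff a).1 haw with h2 | rfl
    · exact h2
    · exact absurd (hab.antisymm hbw) hne
  · exact haw.trans h1.anc

/-- The minima describe the parts that the root path of `y` shares with those of `x` and of `z`.
Both are initial pieces of one path, hence nested: of two edges violating this, one is above the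
other and already completely filled. -/
theorem min_mass_nested (x y z : T.Point) :
    (∀ a, min (T.mass r a x) (T.mass r a y) ≤ min (T.mass r a y) (T.mass r a z)) ∨
    (∀ a, min (T.mass r a y) (T.mass r a z) ≤ min (T.mass r a x) (T.mass r a y)) := by
  by_contra! hcon
  obtain ⟨⟨a, ha⟩, b, hb⟩ := hcon
  have hne : a ≠ b := by rintro rfl; exact lt_asymm ha hb
  have pos : ∀ c (u v : T.Point), 0 ≤ min (T.mass r c u) (T.mass r c v) :=
    fun c u v => le_min (mass_nonneg c u) (mass_nonneg c v)
  have hax := lt_min_iff.1 ((pos a y z).trans_lt ha)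
  have hbx := lt_min_iff.1 ((pos b x y).trans_lt hb)
  obtain ⟨w, hw, haw⟩ := exists_anc_of_mass_pos hax.2
  have hone : T.Anc r a b ∨ T.Anc r b a := by
    obtain ⟨w', hw', hbw⟩ := exists_anc_of_mass_pos hbx.1
    rcases eq_or_ne w w' with rfl | hww
    · exact haw.total hbw
    rcases isChild_or_isChild (r := r) (y.adj w w' hww hw hw') with h1 | h1
    · exact (haw.trans h1.anc).total hbw
    · exact haw.total (hbw.trans h1.anc)
  rcases hone with h1 | h1
  · rw [mass_eq_one_of_anc h1 hne hbx.1, mass_eq_one_of_anc h1 hne hbx.2, min_self] at ha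
    exact (min_le_right _ _).not_gt ha
  · rw [mass_eq_one_of_anc h1 hne.symm hax.1, mass_eq_one_of_anc h1 hne.symm hax.2, min_self] at hb
    exact (min_le_left _ _).not_gt hb

theorem cutDist_self (x : T.Point) : T.cutDist r x x = 0 := by simp [cutDist]

theorem cutDist_comm (x y : T.Point) : T.cutDist r x y = T.cutDist r y x := by
  simp only [cutDist, abs_sub_comm]

theorem cutDist_triangle (x y z : T.Point) :
    T.cutDist r x z ≤ T.cutDist r x y + T.cutDist r y z := by
  simp only [cutDist, ← Finset.sum_add_distrib, ← mul_add]
  exact Finset.sum_le_sum fun a _ =>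
    mul_le_mul_of_nonneg_left (abs_sub_le _ _ _) (edgeLen_nonneg a)

theorem cutDist_nonneg (x y : T.Point) : 0 ≤ T.cutDist r x y :=
  Finset.sum_nonneg fun a _ => mul_nonneg (edgeLen_nonneg a) (abs_nonneg _)

/-- `ht` is the depth and `g` the Gromov product at the root, the length of the common part of two
root paths. Nestedness makes `g` ultrametric, which yields the four-point condition. -/
theorem cutDist_four_point (x y z w : T.Point) :
    T.cutDist r x y + T.cutDist r z w ≤
      max (T.cutDist r x z + T.cutDist r y w) (T.cutDist r x w + T.cutDist r y z) := by
  let g : T.Point → T.Point → ℝ := fun x y =>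
    ∑ a, T.edgeLen r a * min (T.mass r a x) (T.mass r a y)
  let ht : T.Point → ℝ := fun x => ∑ a, T.edgeLen r a * T.mass r a x
  have hg : ∀ x y, T.cutDist r x y = ht x + ht y - 2 * g x y := fun x y => by
    simp only [cutDist, ht, g, Finset.mul_sum, ← Finset.sum_add_distrib,
      ← Finset.sum_sub_distrib]
    refine Finset.sum_congr rfl fun a _ => ?_
    rcases le_total (T.mass r a x) (T.mass r a y) with h | h
    · rw [min_eq_left h, abs_of_nonpos (by linarith)]; ring
    · rw [min_eq_right h, abs_of_nonneg (by linarith)]; ring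
  have gcomm : ∀ x y, g x y = g y x := fun x y => by simp only [g, min_comm]
  have ultra : ∀ x y z, min (g x y) (g y z) ≤ g x z := fun x y z => by
    have mono : ∀ f₁ f₂ : V → ℝ, (∀ a, f₁ a ≤ f₂ a) →
        ∑ a, T.edgeLen r a * f₁ a ≤ ∑ a, T.edgeLen r a * f₂ a := fun f₁ f₂ h =>
      Finset.sum_le_sum fun a _ => mul_le_mul_of_nonneg_left (h a) (edgeLen_nonneg a)
    rcases min_mass_nested (r := r) x y z with h | h
    · exact min_le_of_left_le (mono _ _ fun a =>
        le_min (min_le_left _ _) ((h a).trans (min_le_right _ _)))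
    · exact min_le_of_right_le (mono _ _ fun a =>
        le_min ((h a).trans (min_le_left _ _)) (min_le_right _ _))
  rw [hg, hg, hg, hg, hg, hg]
  have h1 := ultra x z y
  have h2 := ultra x w y
  have h3 := ultra z x w
  have h4 := ultra z y w
  rw [gcomm z y] at h1
  rw [gcomm w y] at h2
  rw [gcomm z x] at h3
  rw [gcomm z y] at h4
  rw [min_le_iff] at h1 h2 h3 h4
  rw [le_max_iff]
  by_contra! hcon
  rcases h1 with h1 | h1 <;> rcases h2 with h2 | h2 <;> rcases h3 with h3 | h3 <;>
    rcases h4 with h4 | h4 <;> linarith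

/-- The sum of the edge lengths along a path is the cut distance of its ends. -/
theorem sum_len_edges_eq {u v : V} (p : T.graph.Walk u v) (hp : p.IsPath) :
    (p.edges.map T.len).sum = T.cutDist r (T.vertexPoint u) (T.vertexPoint v) := by
  classical
  induction p with
  | nil => simp [cutDist_self]
  | @cons u u' v hadj p ih =>
    rw [SimpleGraph.Walk.cons_isPath_iff] at hp
    rw [SimpleGraph.Walk.edges_cons, List.map_cons, List.sum_cons, ih hp.1]
    -- `c` is the lower end of the first edge. Only its cut separates `u` from `u'`, and the rest of
    -- the path never crosses it back.
    have key : ∀ c, T.edgeLen r c = T.len s(u, u') →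
        (∀ a, |T.ind r a u - T.ind r a v| =
          |T.ind r a u' - T.ind r a v| + if a = c then 1 else 0) →
        T.len s(u, u') + T.cutDist r (T.vertexPoint u') (T.vertexPoint v) =
          T.cutDist r (T.vertexPoint u) (T.vertexPoint v) := fun c hc h => by
      simp only [cutDist, mass_vertexPoint, h, mul_add, Finset.sum_add_distrib]
      simp [hc, add_comm]
    rcases isChild_or_isChild (r := r) hadj with h | h
    · refine key u' h.edgeLen_eq fun a => ?_
      split_ifs with ha
      · subst ha
        rw [ind_of_not_anc h.not_anc, ind_of_anc (anc_refl a),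
          ind_of_anc ((anc_iff_of_walk p hp.2 h).1 (anc_refl a))]
        norm_num
      · rw [h.ind_eq ha, add_zero]
    · refine key u (by rw [h.edgeLen_eq, Sym2.eq_swap]) fun a => ?_
      split_ifs with ha
      · subst ha
        rw [ind_of_anc (anc_refl a), ind_of_not_anc h.not_anc,
          ind_of_not_anc (mt (anc_iff_of_walk' p hp.2).2 h.not_anc)]
        norm_num
      · rw [h.ind_eq ha, add_zero]

theorem vdist_eq (u v : V) :
    T.vdist u v = T.cutDist r (T.vertexPoint u) (T.vertexPoint v) :=
  sum_len_edges_eq _ (T.vpath_isPath u v)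

/-- The indicator at `u` is 0 or 1, an extreme value, so all differences have one sign and averaging
commutes with the absolute value. -/
theorem abs_ind_sub_mass (a u : V) (x : T.Point) :
    |T.ind r a u - T.mass r a x| = ∑ w, x.wt w * |T.ind r a u - T.ind r a w| := by
  by_cases h : T.Anc r a u
  · rw [ind_of_anc h, abs_of_nonneg (sub_nonneg.2 (mass_le_one a x)), one_sub_mass]
    exact Finset.sum_congr rfl fun w _ => by
      rw [abs_of_nonneg (sub_nonneg.2 (ind_le_one a w))]
  · rw [ind_of_not_anc h, zero_sub, abs_neg, abs_of_nonneg (mass_nonneg a x)]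
    exact Finset.sum_congr rfl fun w _ => by
      rw [zero_sub, abs_neg, abs_of_nonneg (ind_nonneg a w)]

theorem offset_eq (x : T.Point) (u : V) : T.offset x u = T.cutDist r (T.vertexPoint u) x := by
  simp only [offset, vdist_eq (r := r), cutDist, mass_vertexPoint, abs_ind_sub_mass,
    Finset.mul_sum]
  rw [Finset.sum_comm]
  exact Finset.sum_congr rfl fun a _ => Finset.sum_congr rfl fun w _ => by ring

theorem wt_eq_zero_of_adj {x : T.Point} {b c w : V} (hadj : T.graph.Adj b c) (hb : x.wt b ≠ 0)
    (hc : x.wt c ≠ 0) (hwb : w ≠ b) (hwc : w ≠ c) : x.wt w = 0 := by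
  by_contra hw
  exact not_adj_of_adj_of_adj (x.adj w b hwb hw hb) hadj (x.adj w c hwc hw hc)

theorem wt_add_wt_eq_one {x : T.Point} {b c : V} (hne : b ≠ c)
    (h : ∀ w, w ≠ b → w ≠ c → x.wt w = 0) : x.wt b + x.wt c = 1 := by
  classical
  rw [← x.sum_eq_one, ← Finset.sum_pair hne]
  refine Finset.sum_subset (Finset.subset_univ _) fun w _ hw => ?_
  simp only [Finset.mem_insert, Finset.mem_singleton, not_or] at hw
  exact h w hw.1 hw.2

theorem IsChild.mass_eq {b c : V} (h : T.IsChild r b c) {x : T.Point}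
    (hx : ∀ w, w ≠ b → w ≠ c → x.wt w = 0) {a : V} (ha : a ≠ c) :
    T.mass r a x = T.ind r a b := by
  refine mass_eq_of_forall fun w hw => ?_
  by_cases hwb : w = b
  · rw [hwb]
  by_cases hwc : w = c
  · rw [hwc, h.ind_eq ha]
  · exact absurd (hx w hwb hwc) hw

theorem IsChild.mass_self {b c : V} (h : T.IsChild r b c) {x : T.Point}
    (hx : ∀ w, w ≠ b → w ≠ c → x.wt w = 0) : T.mass r c x = x.wt c := by
  classical
  rw [mass, Finset.sum_eq_single c, ind_of_anc (anc_refl c), mul_one]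
  · intro w _ hwc
    by_cases hwb : w = b
    · rw [hwb, ind_of_not_anc h.not_anc, mul_zero]
    · rw [hx w hwb hwc, zero_mul]
  · simp

theorem cutDist_of_same_edge {x y : T.Point} {u v : V} (hadj : T.graph.Adj u v)
    (h : ∀ w, w ≠ u → w ≠ v → x.wt w = 0 ∧ y.wt w = 0) :
    T.len s(u, v) * |x.wt u - y.wt u| = T.cutDist r x y := by
  classical
  have key : ∀ b c : V, T.IsChild r b c → (∀ w, w ≠ b → w ≠ c → x.wt w = 0 ∧ y.wt w = 0) →
      T.cutDist r x y = T.len s(b, c) * |x.wt c - y.wt c| := fun b c hc h => by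
    rw [cutDist, Finset.sum_eq_single c, hc.edgeLen_eq, hc.mass_self fun w h1 h2 => (h w h1 h2).1,
      hc.mass_self fun w h1 h2 => (h w h1 h2).2]
    · intro a _ ha
      rw [hc.mass_eq (fun w h1 h2 => (h w h1 h2).1) ha,
        hc.mass_eq (fun w h1 h2 => (h w h1 h2).2) ha, sub_self, abs_zero, mul_zero]
    · simp
  rcases isChild_or_isChild (r := r) hadj with hc | hc
  · have h1 := wt_add_wt_eq_one hadj.ne fun w h1 h2 => (h w h1 h2).1
    have h2 := wt_add_wt_eq_one hadj.ne fun w h1 h2 => (h w h1 h2).2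
    rw [key u v hc h, abs_sub_comm (x.wt v)]
    congr 2
    linarith
  · rw [key v u hc fun w h1 h2 => h w h2 h1, Sym2.eq_swap]

/-- Unless `x` and `y` are interior points of one edge, `x` can be joined to `y` through an
endpoint of the edge of `x` without a detour. -/
theorem exists_cutDist_add_eq (x y : T.Point)
    (h : ∀ b c, T.graph.Adj b c → x.wt b ≠ 0 → x.wt c ≠ 0 → y.wt b ≠ 0 → y.wt c = 0) :
    ∃ u, x.wt u ≠ 0 ∧ T.cutDist r x (T.vertexPoint u) + T.cutDist r (T.vertexPoint u) y =
      T.cutDist r x y := by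
  classical
  by_cases hx : ∃ b c, b ≠ c ∧ x.wt b ≠ 0 ∧ x.wt c ≠ 0
  · obtain ⟨b, c, hb, hc, hbc⟩ : ∃ b c, x.wt b ≠ 0 ∧ x.wt c ≠ 0 ∧ T.IsChild r b c := by
      obtain ⟨b, c, hne, hb, hc⟩ := hx
      rcases isChild_or_isChild (r := r) (x.adj b c hne hb hc) with h1 | h1
      · exact ⟨b, c, hb, hc, h1⟩
      · exact ⟨c, b, hc, hb, h1⟩
    have hne : b ≠ c := fun e => hbc.not_anc (e ▸ anc_refl b)
    have hadj := x.adj b c hne hb hc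
    have hsupp : ∀ w, w ≠ b → w ≠ c → x.wt w = 0 := fun w => wt_eq_zero_of_adj hadj hb hc
    have key : ∀ u, x.wt u ≠ 0 → (∀ a, a ≠ c → T.ind r a u = T.ind r a b) →
        |T.mass r c x - T.ind r c u| + |T.ind r c u - T.mass r c y| =
          |T.mass r c x - T.mass r c y| →
        ∃ u, x.wt u ≠ 0 ∧ T.cutDist r x (T.vertexPoint u) +
          T.cutDist r (T.vertexPoint u) y = T.cutDist r x y := fun u hu h1 h2 => by
      refine ⟨u, hu, ?_⟩
      simp only [cutDist, ← Finset.sum_add_distrib, ← mul_add, mass_vertexPoint]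
      refine Finset.sum_congr rfl fun a _ => ?_
      congr 1
      by_cases ha : a = c
      · rw [ha, h2]
      · rw [hbc.mass_eq hsupp ha, h1 a ha, sub_self, abs_zero, zero_add]
    -- Leave through the lower end `c` if `y` has weight below it, otherwise through `b`. By `h`,
    -- the support of `y` cannot straddle this edge.
    by_cases hy : ∃ w, y.wt w ≠ 0 ∧ T.Anc r c w
    · obtain ⟨w, hw, hcw⟩ := hy
      have h1 : T.mass r c y = 1 := mass_eq_of_forall fun w' hw' => by
        by_contra hne1
        have hcw' : ¬ T.Anc r c w' := fun h' => hne1 (ind_of_anc h')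
        have hww : w ≠ w' := fun e => hcw' (e ▸ hcw)
        rcases isChild_or_isChild (r := r) (y.adj w w' hww hw hw') with h2 | h2
        · exact hcw' (hcw.trans h2.anc)
        · rcases (h2.anc_iff c).1 hcw with h3 | rfl
          · exact hcw' h3
          · obtain rfl := hbc.parent_unique h2
            exact hw (h b c hadj hb hc hw')
      refine key c hc (fun a ha => hbc.ind_eq ha) ?_
      rw [h1, ind_of_anc (anc_refl c), sub_self, abs_zero, add_zero]
    · push Not at hy
      have h1 : T.mass r c y = 0 := mass_eq_of_forall fun w' hw' => ind_of_not_anc (hy w' hw')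
      refine key b hb (fun a _ => rfl) ?_
      rw [h1, ind_of_not_anc hbc.not_anc, sub_self, abs_zero, add_zero]
  · push Not at hx
    obtain ⟨u, hu⟩ : ∃ u, x.wt u ≠ 0 := by
      by_contra! h0
      have := x.sum_eq_one
      simp [h0] at this
    refine ⟨u, hu, ?_⟩
    have hm : ∀ a, T.mass r a x = T.ind r a u := fun a => mass_eq_of_forall fun w hw => by
      by_cases hwu : w = u
      · rw [hwu]
      · exact absurd (hx w u hwu hw) hu
    simp [cutDist, mass_vertexPoint, hm]

variable (r) in
theorem cutDist_mem_routeLengths (x y : T.Point) : T.cutDist r x y ∈ T.routeLengths x y := by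
  by_cases h : ∃ b c, T.graph.Adj b c ∧ x.wt b ≠ 0 ∧ x.wt c ≠ 0 ∧ y.wt b ≠ 0 ∧ y.wt c ≠ 0
  · obtain ⟨b, c, hadj, h1, h2, h3, h4⟩ := h
    have hsupp : ∀ w, w ≠ b → w ≠ c → x.wt w = 0 ∧ y.wt w = 0 := fun w hb hc =>
      ⟨wt_eq_zero_of_adj hadj h1 h2 hb hc, wt_eq_zero_of_adj hadj h3 h4 hb hc⟩
    exact Or.inl ⟨b, c, hadj, hsupp, (cutDist_of_same_edge hadj hsupp).symm⟩
  · push Not at h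
    obtain ⟨u, hu, hxu⟩ := exists_cutDist_add_eq (r := r) x y h
    obtain ⟨v, hv, hyv⟩ := exists_cutDist_add_eq (r := r) y (T.vertexPoint u)
      (fun b c hadj _ _ hb => by
        simp only [vertexPoint, ne_eq, ite_eq_right_iff, one_ne_zero, imp_false, not_not] at hb ⊢
        rintro rfl
        exact hadj.ne hb)
    refine Or.inr ⟨u, v, hu, hv, ?_⟩
    rw [offset_eq (r := r), offset_eq (r := r), vdist_eq (r := r)]
    linarith [cutDist_comm (r := r) x (T.vertexPoint u), cutDist_comm (r := r) y (T.vertexPoint u),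
      cutDist_comm (r := r) y (T.vertexPoint v),
      cutDist_comm (r := r) (T.vertexPoint u) (T.vertexPoint v)]

variable (r) in
-- By the triangle inequality no route is shorter than the cut distance, and some route attains it.
theorem dist_eq_cutDist (x y : T.Point) : T.dist x y = T.cutDist r x y := by
  refine IsLeast.csInf_eq ⟨cutDist_mem_routeLengths r x y, ?_⟩
  rintro _ (⟨u, v, hadj, h, rfl⟩ | ⟨u, v, -, -, rfl⟩)
  · exact (cutDist_of_same_edge hadj h).ge
  · rw [offset_eq (r := r), offset_eq (r := r), vdist_eq (r := r)]
    linarith [cutDist_triangle (r := r) x (T.vertexPoint u) y,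
      cutDist_triangle (r := r) (T.vertexPoint u) (T.vertexPoint v) y,
      cutDist_comm (r := r) x (T.vertexPoint u)]

/-! ### Geodesics -/

variable (T r) in
/-- `x` and `y` are joined by a geodesic. -/
def Joined (x y : T.Point) : Prop :=
  ∀ s, 0 ≤ s → s ≤ T.cutDist r x y →
    ∃ z, T.cutDist r x z = s ∧ T.cutDist r z y = T.cutDist r x y - s

theorem Joined.symm {x y : T.Point} (h : T.Joined r x y) : T.Joined r y x := fun s h0 h1 => by
  rw [cutDist_comm] at h1
  obtain ⟨z, hz1, hz2⟩ := h (T.cutDist r x y - s) (by linarith) (by linarith)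
  exact ⟨z, by rw [cutDist_comm, hz2]; ring, by rw [cutDist_comm, hz1, cutDist_comm y]⟩

theorem Joined.trans {x y z : T.Point} (hxy : T.Joined r x y) (hyz : T.Joined r y z)
    (h : T.cutDist r x y + T.cutDist r y z = T.cutDist r x z) : T.Joined r x z := fun s h0 h1 => by
  rcases le_total s (T.cutDist r x y) with hs | hs
  · obtain ⟨w, hw1, hw2⟩ := hxy s h0 hs
    refine ⟨w, hw1, ?_⟩
    linarith [cutDist_triangle (r := r) w y z, cutDist_triangle (r := r) x w z]
  · obtain ⟨w, hw1, hw2⟩ := hyz (s - T.cutDist r x y) (by linarith) (by linarith)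
    have h2 : T.cutDist r w z = T.cutDist r x z - s := by linarith
    refine ⟨w, ?_, h2⟩
    linarith [cutDist_triangle (r := r) x y w, cutDist_triangle (r := r) x w z]

/-- With both supports in one edge, convex combinations are again points, and `mass` is affine in
them. -/
theorem joined_of_adj {x y : T.Point}
    (h : ∀ u v, u ≠ v → (x.wt u ≠ 0 ∨ y.wt u ≠ 0) → (x.wt v ≠ 0 ∨ y.wt v ≠ 0) →
      T.graph.Adj u v) : T.Joined r x y := fun s h0 h1 => by
  rcases (cutDist_nonneg (r := r) x y).eq_or_lt with hD | hD
  · refine ⟨x, ?_, ?_⟩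
    · rw [cutDist_self]; linarith
    · linarith
  set D := T.cutDist r x y with hDdef
  obtain ⟨t, ht, ht0, ht1⟩ : ∃ t, t * D = s ∧ 0 ≤ t ∧ t ≤ 1 :=
    ⟨s / D, div_mul_cancel₀ _ hD.ne', by positivity, (div_le_one hD).2 h1⟩
  let z : T.Point :=
    { wt := fun v => (1 - t) * x.wt v + t * y.wt v
      nonneg := fun v => add_nonneg (mul_nonneg (by linarith) (x.nonneg v))
        (mul_nonneg ht0 (y.nonneg v))
      sum_eq_one := by
        rw [Finset.sum_add_distrib, ← Finset.mul_sum, ← Finset.mul_sum, x.sum_eq_one,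
          y.sum_eq_one]
        ring
      adj := fun u v hne hu hv => by
        have key : ∀ w, (1 - t) * x.wt w + t * y.wt w ≠ 0 → x.wt w ≠ 0 ∨ y.wt w ≠ 0 :=
          fun w hw => by
            by_contra! h0
            exact hw (by rw [h0.1, h0.2]; ring)
        exact h u v hne (key u hu) (key v hv) }
  have hz : ∀ a, T.mass r a z = (1 - t) * T.mass r a x + t * T.mass r a y := fun a => by
    simp only [mass, Finset.mul_sum, ← Finset.sum_add_distrib, z]
    exact Finset.sum_congr rfl fun w _ => by ring
  have h2 : T.cutDist r x z = t * D := by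
    simp only [hDdef, cutDist, Finset.mul_sum]
    refine Finset.sum_congr rfl fun a _ => ?_
    rw [hz, show T.mass r a x - ((1 - t) * T.mass r a x + t * T.mass r a y) =
      t * (T.mass r a x - T.mass r a y) by ring, abs_mul, abs_of_nonneg ht0]
    ring
  have h3 : T.cutDist r z y = (1 - t) * D := by
    simp only [hDdef, cutDist, Finset.mul_sum]
    refine Finset.sum_congr rfl fun a _ => ?_
    rw [hz, show (1 - t) * T.mass r a x + t * T.mass r a y - T.mass r a y =
      (1 - t) * (T.mass r a x - T.mass r a y) by ring, abs_mul, abs_of_nonneg (by linarith)]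
    ring
  exact ⟨z, by rw [h2, ht], by rw [h3, ← ht]; ring⟩

theorem eq_of_vertexPoint_wt_ne_zero {u v : V} (h : (T.vertexPoint v).wt u ≠ 0) : u = v := by
  simpa [vertexPoint] using h

theorem joined_vertexPoint_of_walk {u v : V} (p : T.graph.Walk u v) (hp : p.IsPath) :
    T.Joined r (T.vertexPoint u) (T.vertexPoint v) := by
  induction p with
  | @nil u =>
    refine joined_of_adj fun a b hne ha hb => ?_
    rw [or_self] at ha hb
    exact absurd ((eq_of_vertexPoint_wt_ne_zero ha).trans (eq_of_vertexPoint_wt_ne_zero hb).symm) hne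
  | @cons u u' v hadj p ih =>
    have h1 := sum_len_edges_eq (r := r) _ hp
    rw [SimpleGraph.Walk.cons_isPath_iff] at hp
    refine Joined.trans (joined_of_adj fun a b hne ha hb => ?_) (ih hp.1) ?_
    · rcases ha with ha | ha <;> rcases hb with hb | hb <;>
        obtain rfl := eq_of_vertexPoint_wt_ne_zero ha <;>
        obtain rfl := eq_of_vertexPoint_wt_ne_zero hb
      exacts [absurd rfl hne, hadj, hadj.symm, absurd rfl hne]
    · rw [← h1, SimpleGraph.Walk.edges_cons, List.map_cons, List.sum_cons,
        sum_len_edges_eq (r := r) _ hp.1,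
        ← sum_len_edges_eq (r := r) hadj.toWalk (by simpa using hadj.ne)]
      simp

theorem joined_vertexPoint {x : T.Point} {u : V} (hu : x.wt u ≠ 0) :
    T.Joined r x (T.vertexPoint u) :=
  joined_of_adj fun a b hne ha hb =>
    x.adj a b hne (ha.elim id fun h => (eq_of_vertexPoint_wt_ne_zero h) ▸ hu)
      (hb.elim id fun h => (eq_of_vertexPoint_wt_ne_zero h) ▸ hu)

variable (r) in
theorem joined (x y : T.Point) : T.Joined r x y := by
  -- A route attaining the cut distance is a geodesic: equality holds in each triangle inequality
  -- along it.
  rcases cutDist_mem_routeLengths r x y with ⟨u, v, hadj, h, -⟩ | ⟨u, v, hu, hv, h⟩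
  · have key : ∀ a, x.wt a ≠ 0 ∨ y.wt a ≠ 0 → a = u ∨ a = v := fun a ha => by
      by_contra! hcon
      have := h a hcon.1 hcon.2
      tauto
    refine joined_of_adj fun a b hne ha hb => ?_
    rcases key a ha with rfl | rfl <;> rcases key b hb with rfl | rfl
    exacts [absurd rfl hne, hadj, hadj.symm, absurd rfl hne]
  · rw [offset_eq (r := r), offset_eq (r := r), vdist_eq (r := r),
      cutDist_comm (T.vertexPoint u) x] at h
    have h1 := cutDist_triangle (r := r) x (T.vertexPoint u) y
    have h2 := cutDist_triangle (r := r) (T.vertexPoint u) (T.vertexPoint v) y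
    exact (joined_vertexPoint hu).trans ((joined_vertexPoint_of_walk _ (T.vpath_isPath u v)).trans
      (joined_vertexPoint hv).symm (by linarith)) (by linarith)

variable (T) in
/-- The distance of a metric tree is a tree distance. -/
theorem isTreeDist : IsTreeDist T.dist := by
  obtain ⟨r⟩ := T.isTree.connected.nonempty
  have h : T.dist = T.cutDist r := by ext x y; exact dist_eq_cutDist r x y
  rw [h]
  exact ⟨cutDist_self, cutDist_comm, cutDist_triangle, cutDist_four_point, joined r⟩

end Coordinates

end MetricTree

/-! ### The main theorem -/

theorem mainTheorem3 {V : Type*} [Fintype V] (T : MetricTree V)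
    {n : ℕ} (hn : 1 ≤ n) (P : Fin n → T.UncertainPoint)
    (p : Fin n → T.Point) (hp : ∀ i, MetricTree.IsMedian (p i) (P i))
    (k : ℕ) (hk : 1 ≤ k) (hT : ∃ C : Finset T.Point, C.card = k) :
    IsLeast (MetricTree.coveringRanges P k) (MetricTree.optCoveringRange P k) ∧
    ((∃ i, MetricTree.optCoveringRange P k = MetricTree.Ed (p i) (P i)) ∨
      ∃ i j, i ≠ j ∧
        (MetricTree.crossings (p i) (p j) (P i) (P j)).Nonempty ∧
        ∀ c ∈ MetricTree.crossings (p i) (p j) (P i) (P j),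
          MetricTree.optCoveringRange P k = MetricTree.Ed c (P i) ∧
          MetricTree.optCoveringRange P k = MetricTree.Ed c (P j)) := by
  have : Nonempty (Fin n) := ⟨⟨0, hn⟩⟩
  have h := T.isTreeDist
  choose r z hz hz' hr hval using fun i j =>
    MetricTree.exists_optimal_pair_center h (hp i) (hp j)
  obtain ⟨i, j, hleast⟩ := MetricTree.isLeast_coveringRanges h
    (fun i j => ⟨z i j, hz i j, hz' i j⟩) hr hk hT
  have hopt : MetricTree.optCoveringRange P k = r i j := hleast.csInf_eq
  rw [hopt]
  refine ⟨hleast, ?_⟩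
  rcases hval i j with h1 | h1 | h1
  · exact Or.inl ⟨i, h1⟩
  · exact Or.inl ⟨j, h1⟩
  -- The diagonal pair stands for a single uncertain point; its value is the minimum of its own
  -- cost, attained at the median.
  · rcases eq_or_ne i j with rfl | hij
    · refine Or.inl ⟨i, le_antisymm ?_ ((hp i _).trans (hz i i))⟩
      simpa using hr i i (p i)
    · exact Or.inr ⟨i, j, hij, h1⟩
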